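/- All graphs are finite and simple; $\lambda(G)$ denotes the spectral radius of $G$, i.e. the largest modulus of an eigenvalue of its adjacency matrix. Let $S_{n,2}=K_2\vee (n-2)K_1$ be the book graph on $n$ vertices (the join of an edge and $n-2$ isolated vertices), and let $S_{n,2}^t$ be the graph on $n$ vertices obtained from $S_{n-t,2}$ by attaching $t$ pendant vertices to a vertex of maximum degree of $S_{n-t,2}$. For a positive integer $m$ put $$\psi_1(x)=\begin{cases} x^4-mx^2-(m-2)x+\frac m2-1, & m \text{ even},\\ x^4-mx^2-(m-3)x+m-3, & m\text{ odd.}\end{cases}$$ **Theorem 1.3.** Let $m\ge 22$, and let $G$ be a graph with $m$ edges and no isolated vertices which does not contain $C_5$ as a (not necessarily induced) subgraph and which, if $m$ is odd, is not isomorphic to $S_{\frac{m+3}{2},2}$. Then $\psi_1$ has a largest real zero $\rho_1(m)$, and $$\lambda(G)\le \rho_1(m).$$ Equality holds if and only if $G\cong S^1_{\frac{m+4}{2},2}$ when $m$ is even, and if and only if $G\cong S^2_{\frac{m+5}{2},2}$ when $m$ is odd. -/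

import Mathlib

open scoped SimpleGraph

namespace SizeSpectral

/-- The join `G ∨ H`: the disjoint union of `G` and `H` together with all edges between them. -/
def join {V W : Type*} (G : SimpleGraph V) (H : SimpleGraph W) : SimpleGraph (V ⊕ W) :=
  (G ⊕g H) ⊔ completeBipartiteGraph V W

/-- The complete split graph `S_{n,k} = K_k ∨ (n - k) K_1`, for `k ≤ n`. For `k = 2` it is the book
graph, i.e. triangles sharing one common edge. -/
def completeSplit (n k : ℕ) : SimpleGraph (Fin k ⊕ Fin (n - k)) :=
  join (⊤ : SimpleGraph (Fin k)) (⊥ : SimpleGraph (Fin (n - k)))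

/-- The graph obtained from `G` by attaching `t` new pendant vertices to the vertex `v`. -/
def attachPendants {V : Type*} (G : SimpleGraph V) (v : V) (t : ℕ) : SimpleGraph (V ⊕ Fin t) :=
  (G ⊕g (⊥ : SimpleGraph (Fin t))) ⊔
    SimpleGraph.fromRel fun x y => x = Sum.inl v ∧ ∃ i, y = Sum.inr i

/-- The graph `S_{n,k}^t` of order `n` (for `1 ≤ k` and `k + t ≤ n`), obtained from `S_{n-t,k}` by
attaching `t` pendant vertices to a vertex of maximum degree. The vertices of the clique `K_k` are
adjacent to all others, hence have maximum degree, and automorphisms permute them arbitrarily, so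
the first of them is used. -/
def splitPendant (n k t : ℕ) [NeZero k] : SimpleGraph ((Fin k ⊕ Fin (n - t - k)) ⊕ Fin t) :=
  attachPendants (completeSplit (n - t) k) (Sum.inl 0) t

/-- The spectral radius `λ(G)`: the largest modulus of an eigenvalue of the adjacency matrix (a real
symmetric matrix, so that all its eigenvalues are real). -/
noncomputable def lam {V : Type*} [Fintype V] [DecidableEq V] (G : SimpleGraph V)
    [DecidableRel G.Adj] : ℝ :=
  (spectralRadius ℝ (G.adjMatrix ℝ)).toReal

/-- The quartic `ψ₁`, whose form depends on the parity of `m`. -/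
noncomputable def psi1 (m : ℕ) (x : ℝ) : ℝ :=
  if Even m then x ^ 4 - m * x ^ 2 - ((m : ℝ) - 2) * x + (m : ℝ) / 2 - 1
  else x ^ 4 - m * x ^ 2 - ((m : ℝ) - 3) * x + m - 3

/-- The largest zero `ρ₁(m)` of `ψ₁`. -/
noncomputable def rho1 (m : ℕ) : ℝ := sSup {x : ℝ | psi1 m x = 0}

/-- `G ∈ 𝔊(m, C₅)`: `G` has `m` edges, no isolated vertices, contains no `C₅` as a (not necessarily
induced) subgraph, and is not the book graph `S_{(m+3)/2,2}` (which exists only for odd `m`). -/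
structure InFamily (m : ℕ) {V : Type*} [Fintype V] [DecidableEq V] (G : SimpleGraph V)
    [DecidableRel G.Adj] : Prop where
  size : G.edgeFinset.card = m
  noIsolated : ∀ v, ¬ G.IsIsolated v
  c5Free : (SimpleGraph.cycleGraph 5).Free G
  notBook : Odd m → IsEmpty (G ≃g completeSplit ((m + 3) / 2) 2)

end SizeSpectral

/-! Write `m = 2k + t + 1`, with `t = 1` for even `m` and `t = 2` for odd `m`; then `psi1 m` is
`bookQuartic k t`. Let `ρ` be its largest zero and suppose that `λ = lam G ≥ ρ`. Then `λ² - λ > 2k +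
t/2`, so `m - (λ² - λ) < 1 + t/2 ≤ 2`.

Scale a Perron vector `x` so that its largest entry is `x u = 1`. Counting two-step walks from `u`
(`size_sub_eq`) splits `m - (λ² - λ)` into a defect for each neighbour of `u`, a term `codeg * (1 -
x w)` for each far vertex `w`, and the number of edges among far vertices. Without pentagons, the
neighbours of `u` induce isolated vertices, stars and triangles. An isolated vertex `v` contributes
`x v`, a star at least 1, and a triangle at least 2 once the far vertices are counted with it. A
budget below 2 therefore leaves exactly one star, and then no far vertex
(`NoPentagon.exists_spine`): `G` is a book with pendant edges at `u`.

If that book has `r` pages and `s` pendant edges, `λ` is a zero of `bookQuartic r s`. By parity, and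
because the plain book is excluded, `s ≥ t`. At equal size, `s > t` would make `bookQuartic k t`
negative at `λ`, although it is nonnegative from `ρ` on. So `s = t`, `λ = ρ` and `G` is the extremal
graph. Conversely, an explicit eigenvector gives that graph the eigenvalue `ρ`. -/

namespace SizeSpectral

/-! ### Perron vectors and the spectral radius -/

section Perron

variable {V : Type*} [Fintype V] [DecidableEq V]

/-- A nonnegative symmetric real matrix has a nonnegative eigenvector whose eigenvalue dominates the
modulus of every eigenvalue. -/
theorem exists_nonneg_eigenvector [Nonempty V] (A : Matrix V V ℝ) (hA : A.IsHermitian)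
    (hA0 : ∀ i j, 0 ≤ A i j) :
    ∃ (μ : ℝ) (y : V → ℝ), (∀ i, 0 ≤ y i) ∧ y ≠ 0 ∧ A.mulVec y = μ • y ∧
      ∀ (ν : ℝ) (z : V → ℝ), z ≠ 0 → A.mulVec z = ν • z → |ν| ≤ μ := by
  classical
  let T : EuclideanSpace ℝ V →L[ℝ] EuclideanSpace ℝ V :=
    LinearMap.toContinuousLinearMap (Matrix.toEuclideanLin A)
  have hTapp : ∀ x : EuclideanSpace ℝ V, (T x).ofLp = A.mulVec x.ofLp := fun x => rfl
  have hT : IsSelfAdjoint T := by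
    rw [ContinuousLinearMap.isSelfAdjoint_iff_isSymmetric]
    exact Matrix.isSymmetric_toEuclideanLin_iff.2 hA
  have hq : ∀ x : EuclideanSpace ℝ V, T.reApplyInnerSelf x = ∑ i, x i * ∑ j, A i j * x j := by
    intro x
    rw [ContinuousLinearMap.reApplyInnerSelf_apply]
    simp only [PiLp.inner_apply, RCLike.re_to_real]
    refine Finset.sum_congr rfl fun i _ => ?_
    rw [hTapp]
    simp [Matrix.mulVec, dotProduct]
  -- Taking absolute values of the entries keeps the norm and, as `A` is nonnegative, does not
  -- decrease the quadratic form. So a maximiser on the sphere may be taken nonnegative, and the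
  -- maximum bounds `|ν|`, not only `ν`.
  let ab : EuclideanSpace ℝ V → EuclideanSpace ℝ V := fun x => WithLp.toLp 2 fun i => |x i|
  have habi : ∀ x i, ab x i = |x i| := fun x i => rfl
  have habn : ∀ x, ‖ab x‖ = ‖x‖ := by
    intro x
    simp [EuclideanSpace.norm_eq, habi]
  have habq : ∀ x, |T.reApplyInnerSelf x| ≤ T.reApplyInnerSelf (ab x) := by
    intro x
    rw [hq, hq]
    refine (Finset.abs_sum_le_sum_abs _ _).trans (Finset.sum_le_sum fun i _ => ?_)
    rw [abs_mul, habi]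
    refine mul_le_mul_of_nonneg_left ?_ (abs_nonneg _)
    refine (Finset.abs_sum_le_sum_abs _ _).trans (Finset.sum_le_sum fun j _ => ?_)
    rw [abs_mul, abs_of_nonneg (hA0 i j), habi]
  obtain ⟨x₀, hx₀, hmax⟩ := (isCompact_sphere (0 : EuclideanSpace ℝ V) 1).exists_isMaxOn
    (NormedSpace.sphere_nonempty.2 zero_le_one) T.reApplyInnerSelf_continuous.continuousOn
  have hx₀n : ‖x₀‖ = 1 := by simpa using hx₀
  set y := ab x₀ with hy
  have hyn : ‖y‖ = 1 := by rw [hy, habn, hx₀n]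
  have hymax : IsMaxOn T.reApplyInnerSelf (Metric.sphere 0 ‖y‖) y := by
    intro z hz
    rw [hyn] at hz
    exact (hmax hz).trans ((le_abs_self _).trans (habq x₀))
  have hy0 : y ≠ 0 := by
    intro h; rw [h] at hyn; simp at hyn
  have hev := hT.hasEigenvector_of_isLocalExtrOn hy0 (Or.inr hymax.localize)
  have hyeq : T y = T.rayleighQuotient y • y := hev.apply_eq_smul
  have hray : T.rayleighQuotient y = T.reApplyInnerSelf y := by
    simp [ContinuousLinearMap.rayleighQuotient, hyn]
  refine ⟨T.rayleighQuotient y, y.ofLp, fun i => abs_nonneg _, ?_, ?_, ?_⟩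
  · intro h
    exact hy0 (by ext i; exact congrFun h i)
  · rw [← hTapp, hyeq]; rfl
  · intro ν z hz hzν
    let w : EuclideanSpace ℝ V := WithLp.toLp 2 z
    have hw0 : w ≠ 0 := by
      intro h
      exact hz (by ext i; exact congrArg (fun v : EuclideanSpace ℝ V => v i) h)
    have hwn : 0 < ‖w‖ := norm_pos_iff.2 hw0
    have hTw : T w = ν • w := by
      ext i
      have := congrFun (hTapp w) i
      rw [this]
      exact congrFun hzν i
    have hqw : T.reApplyInnerSelf w = ν * ‖w‖ ^ 2 := by
      rw [ContinuousLinearMap.reApplyInnerSelf_apply, hTw, inner_smul_left]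
      simp
    have h1 : |ν| * ‖w‖ ^ 2 ≤ T.reApplyInnerSelf (ab w) := by
      have := habq w
      rwa [hqw, abs_mul, abs_of_nonneg (sq_nonneg ‖w‖)] at this
    have h2 : T.reApplyInnerSelf (‖w‖⁻¹ • ab w) ≤ T.reApplyInnerSelf y := by
      apply hymax
      rw [hyn, mem_sphere_zero_iff_norm, norm_smul, habn, norm_inv, norm_norm]
      field_simp
    rw [ContinuousLinearMap.reApplyInnerSelf_smul, norm_inv, norm_norm] at h2
    rw [hray]
    refine le_trans ?_ h2
    rw [inv_pow, inv_mul_eq_div, le_div_iff₀ (by positivity)]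
    exact h1

variable (G : SimpleGraph V) [DecidableRel G.Adj]

theorem mem_spectrum_iff_exists_mulVec (A : Matrix V V ℝ) (ν : ℝ) :
    ν ∈ spectrum ℝ A ↔ ∃ z : V → ℝ, z ≠ 0 ∧ A.mulVec z = ν • z := by
  rw [← Matrix.spectrum_toLin', ← Module.End.hasEigenvalue_iff_mem_spectrum]
  constructor
  · intro h
    obtain ⟨z, hz⟩ := h.exists_hasEigenvector
    exact ⟨z, hz.2, by simpa using hz.apply_eq_smul⟩
  · rintro ⟨z, hz, h⟩
    exact Module.End.hasEigenvalue_of_hasEigenvector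
      ⟨Module.End.mem_eigenspace_iff.2 (by simpa using h), hz⟩

theorem exists_nonneg_mulVec_eq_lam_smul [Nonempty V] :
    ∃ y : V → ℝ, (∀ i, 0 ≤ y i) ∧ y ≠ 0 ∧ (G.adjMatrix ℝ).mulVec y = lam G • y ∧
      ∀ (ν : ℝ) (z : V → ℝ), z ≠ 0 → (G.adjMatrix ℝ).mulVec z = ν • z → |ν| ≤ lam G := by
  obtain ⟨μ, y, hy, hy0, hyμ, hmax⟩ := exists_nonneg_eigenvector (G.adjMatrix ℝ)
    (by
      rw [Matrix.IsHermitian, Matrix.conjTranspose_eq_transpose_of_trivial]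
      exact G.transpose_adjMatrix) (by
      intro i j
      rw [SimpleGraph.adjMatrix_apply]
      split_ifs <;> norm_num)
  have hμ0 : 0 ≤ μ := (abs_nonneg μ).trans (hmax μ y hy0 hyμ)
  have hlam : lam G = μ := by
    have : spectralRadius ℝ (G.adjMatrix ℝ) = ENNReal.ofReal μ := by
      apply le_antisymm
      · refine iSup₂_le fun ν hν => ?_
        obtain ⟨z, hz, hzν⟩ := (mem_spectrum_iff_exists_mulVec _ _).1 hν
        rw [← enorm_eq_nnnorm, Real.enorm_eq_ofReal_abs]
        exact ENNReal.ofReal_le_ofReal (hmax ν z hz hzν)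
      · have hmem : μ ∈ spectrum ℝ (G.adjMatrix ℝ) :=
          (mem_spectrum_iff_exists_mulVec _ _).2 ⟨y, hy0, hyμ⟩
        refine le_trans (le_of_eq ?_)
          (le_iSup₂ (f := fun k (_ : k ∈ spectrum ℝ (G.adjMatrix ℝ)) => (‖k‖₊ : ENNReal)) μ hmem)
        rw [← enorm_eq_nnnorm, Real.enorm_eq_ofReal_abs, abs_of_nonneg hμ0]
    rw [lam, this, ENNReal.toReal_ofReal hμ0]
  exact ⟨y, hy, hy0, hlam ▸ hyμ, hlam ▸ hmax⟩

end Perron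

/-! ### The quartic of a book with pendant edges -/

section Quartic

/-- The polynomial whose largest root is the spectral radius of the graph with `k` triangles on a
common edge and `t` pendant edges at one end of that edge. -/
noncomputable def bookQuartic (k t x : ℝ) : ℝ :=
  x ^ 4 - (2 * k + t + 1) * x ^ 2 - 2 * k * x + k * t

/-- For a book with `k` pages and `t` pendant edges, `2k + t` is the size minus one. At fixed size
only the last summand depends on how the edges are divided. -/
theorem bookQuartic_eq (k t x : ℝ) :
    bookQuartic k t x = (x ^ 2 - x - (2 * k + t)) * (x ^ 2 + x) + t * (x + k) := by
  unfold bookQuartic; ring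

theorem continuous_bookQuartic (k t : ℝ) : Continuous (bookQuartic k t) := by
  unfold bookQuartic; fun_prop

theorem bookQuartic_pos_of_large {k t x : ℝ} (hk : 0 ≤ k) (ht : 0 ≤ t)
    (hx : 2 * k + t + 3 ≤ x) : 0 < bookQuartic k t x := by
  have hx1 : 1 ≤ x := by linarith
  have hx2 : x ≤ x ^ 2 := by nlinarith
  have h3 : x ^ 2 ≤ x ^ 3 := by nlinarith [sq_nonneg x]
  have h4 : (2 * k + t + 3) * x ^ 3 ≤ x ^ 4 := by
    have : x ^ 4 = x * x ^ 3 := by ring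
    rw [this]
    exact mul_le_mul_of_nonneg_right hx (by positivity)
  have h6 : (2 * k + t + 3) * x ^ 2 ≤ (2 * k + t + 3) * (x ^ 3) :=
    mul_le_mul_of_nonneg_left h3 (by linarith)
  have hx3 : (2 * k + t + 3) * x ≤ x ^ 2 := by nlinarith
  have : 0 ≤ k * t := mul_nonneg hk ht
  have : 0 ≤ t * x := by positivity
  unfold bookQuartic
  nlinarith

/-- The zeros of `bookQuartic k t` have a greatest element `ρ`; it satisfies `ρ ^ 2 - ρ > 2 * k`,
and the quartic is nonnegative from there on. -/
theorem exists_isGreatest_bookQuartic {k t : ℝ} (hk : 0 < k) (ht : 0 < t) :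
    ∃ ρ, IsGreatest {x | bookQuartic k t x = 0} ρ ∧ 0 < ρ ∧
      ∀ x, ρ ≤ x → 2 * k < x ^ 2 - x ∧ 0 ≤ bookQuartic k t x := by
  set b := 2 * k + t + 3 with hb
  -- The positive root of `x² - x = 2k`. There the quartic equals `-t(k + x₀) < 0`, so a zero lies
  -- beyond it.
  set x₀ := (1 + √(1 + 8 * k)) / 2 with hx₀
  have hs : √(1 + 8 * k) ^ 2 = 1 + 8 * k := Real.sq_sqrt (by linarith)
  have hs0 : 0 ≤ √(1 + 8 * k) := Real.sqrt_nonneg _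
  have hx₀0 : 1 / 2 ≤ x₀ := by linarith
  have hx₀k : x₀ ^ 2 - x₀ = 2 * k := by rw [hx₀]; linear_combination hs / 4
  have hneg : bookQuartic k t x₀ < 0 := by
    rw [bookQuartic_eq]
    have h1 : x₀ ^ 2 - x₀ - (2 * k + t) = -t := by linarith
    rw [h1]
    nlinarith [mul_pos ht hk]
  have hx₀b : x₀ ≤ b := by
    by_contra h
    exact hneg.not_gt (bookQuartic_pos_of_large hk.le ht.le (not_le.1 h).le)
  have root : ∀ y, x₀ ≤ y → bookQuartic k t y < 0 → ∃ z, y < z ∧ bookQuartic k t z = 0 := by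
    intro y hy hyn
    have hyb : y ≤ b := by
      by_contra h
      exact hyn.not_gt (bookQuartic_pos_of_large hk.le ht.le (not_le.1 h).le)
    have hbpos := bookQuartic_pos_of_large hk.le ht.le (le_refl b)
    obtain ⟨z, hz, hz0⟩ := intermediate_value_Icc hyb (continuous_bookQuartic k t).continuousOn
      ⟨hyn.le, hbpos.le⟩
    refine ⟨z, lt_of_le_of_ne hz.1 ?_, hz0⟩
    rintro rfl
    linarith
  have hbdd : BddAbove {x | bookQuartic k t x = 0} := by
    refine ⟨b, fun x hx => ?_⟩
    by_contra h
    exact (bookQuartic_pos_of_large hk.le ht.le (not_le.1 h).le).ne' hx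
  have hcl : IsClosed {x | bookQuartic k t x = 0} :=
    isClosed_eq (continuous_bookQuartic k t) continuous_const
  obtain ⟨z₀, hz₀, hz₀0⟩ := root x₀ le_rfl hneg
  have hmem := hcl.csSup_mem ⟨z₀, hz₀0⟩ hbdd
  refine ⟨sSup {x | bookQuartic k t x = 0}, ⟨hmem, fun x hx => le_csSup hbdd hx⟩, ?_, ?_⟩
  · have := le_csSup hbdd hz₀0
    linarith
  · intro x hx
    have hxx : x₀ < x := lt_of_lt_of_le hz₀ ((le_csSup hbdd hz₀0).trans hx)
    refine ⟨by nlinarith, ?_⟩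
    by_contra h
    obtain ⟨z, hz, hz0⟩ := root x hxx.le (not_le.1 h)
    have := le_csSup hbdd hz0
    linarith

/-- From `2k < x² - x` follows `t(x + k) < (t/2)(x² + x)`, so the correction term in
`bookQuartic_eq` cannot offset a main factor that is at most `-t/2`. -/
theorem lt_sq_sub_of_bookQuartic_nonneg {k t x : ℝ} (ht : 0 < t) (hx : 0 < x)
    (h : 2 * k < x ^ 2 - x) (hq : 0 ≤ bookQuartic k t x) : 2 * k + t / 2 < x ^ 2 - x := by
  rw [bookQuartic_eq] at hq
  by_contra hc
  have h1 : (x ^ 2 - x - (2 * k + t)) * (x ^ 2 + x) ≤ -(t / 2) * (x ^ 2 + x) :=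
    mul_le_mul_of_nonneg_right (by linarith) (by positivity)
  nlinarith

/-- More pendant edges give a smaller root. -/
theorem bookQuartic_neg_of_pendants {k t r s x : ℝ} (hx : 0 < x) (hr : t ≤ 2 * r)
    (hst : t < s) (hm : 2 * r + s = 2 * k + t) (h : bookQuartic r s x = 0) :
    bookQuartic k t x < 0 := by
  have e := bookQuartic_eq k t x
  have e' := bookQuartic_eq r s x
  rw [hm, h] at e'
  have hk : k = r + (s - t) / 2 := by linarith
  -- This product is `bookQuartic r s x - bookQuartic k t x` for two books of equal size.
  have key : 0 < (s - t) * (x + r - t / 2) := mul_pos (by linarith) (by linarith)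
  rw [e]
  have : s * (x + r) - t * (x + k) = (s - t) * (x + r - t / 2) := by rw [hk]; ring
  linarith

theorem psi1_eq_bookQuartic {m k t : ℕ} (hm : m = 2 * k + t + 1)
    (ht : Even m ∧ t = 1 ∨ Odd m ∧ t = 2) (x : ℝ) : psi1 m x = bookQuartic k t x := by
  unfold psi1 bookQuartic
  rcases ht with ⟨he, rfl⟩ | ⟨ho, rfl⟩
  · rw [if_pos he, hm]; push_cast; ring
  · rw [if_neg (Nat.not_even_iff_odd.2 ho), hm]; push_cast; ring

theorem exists_size_eq {m : ℕ} (hm : 22 ≤ m) : ∃ k t : ℕ, 10 ≤ k ∧ m = 2 * k + t + 1 ∧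
    (Even m ∧ t = 1 ∨ Odd m ∧ t = 2) := by
  rcases Nat.even_or_odd m with h | h
  · obtain ⟨j, hj⟩ := id h
    exact ⟨j - 1, 1, by omega, by omega, Or.inl ⟨h, rfl⟩⟩
  · obtain ⟨j, hj⟩ := id h
    exact ⟨j - 1, 2, by omega, by omega, Or.inr ⟨h, rfl⟩⟩

end Quartic

/-! ### Counting around a vertex, and components of its neighbourhood -/

section Local

variable {V : Type*} [Fintype V] [DecidableEq V] (G : SimpleGraph V) [DecidableRel G.Adj]

/-- The vertices at distance at least two from `u`. -/
def far (u : V) : Finset V := {w | w ≠ u ∧ ¬ G.Adj u w}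

/-- The number of common neighbours of `u` and `v`. -/
def codeg (u v : V) : ℕ := (G.neighborFinset v ∩ G.neighborFinset u).card

/-- The number of neighbours of `v` that are far from `u`. -/
def farDeg (u v : V) : ℕ := (G.neighborFinset v ∩ far G u).card

/-- Elementary form of `C₅`-freeness. -/
def NoPentagon : Prop := ∀ a b c d e, G.Adj a b → G.Adj b c → G.Adj c d → G.Adj d e → G.Adj e a →
  a ≠ c → a ≠ d → b ≠ d → b ≠ e → c ≠ e → False

variable {G} {u : V}

omit [Fintype V] [DecidableEq V] [DecidableRel G.Adj] in
theorem noPentagon_of_free (h : (SimpleGraph.cycleGraph 5).Free G) : NoPentagon G := by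
  intro a b c d e hab hbc hcd hde hea hac had hbd hbe hce
  refine h ⟨⟨⟨![a, b, c, d, e], ?_⟩, ?_⟩⟩
  · intro i j hij
    fin_cases i <;> fin_cases j <;> revert hij <;>
      simp [SimpleGraph.cycleGraph_adj', hab, hbc, hcd, hde, hea, hab.symm, hbc.symm, hcd.symm,
        hde.symm, hea.symm] <;>
      exact fun h => absurd h (by decide)
  · intro i j hij
    fin_cases i <;> fin_cases j <;> revert hij <;>
      simp [hab.ne, hbc.ne, hcd.ne, hde.ne, hea.ne, hab.ne', hbc.ne', hcd.ne',
        hde.ne', hea.ne', hac, had, hbd, hbe, hce, hac.symm, had.symm, hbd.symm, hbe.symm,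
        hce.symm]

@[simp] theorem mem_far {w : V} : w ∈ far G u ↔ w ≠ u ∧ ¬ G.Adj u w := by simp [far]

theorem sum_eq_near_add_far {M : Type*} [AddCommMonoid M] (f : V → M) :
    ∑ v, f v = f u + (∑ v ∈ G.neighborFinset u, f v + ∑ v ∈ far G u, f v) := by
  rw [← Finset.sum_union, ← Finset.sum_insert]
  · congr 1
    ext v
    by_cases h : v = u <;> by_cases h' : G.Adj u v <;> simp [h, h']
  · simp
  · rw [Finset.disjoint_left]
    intro v hv
    simp at hv
    simp [hv]

theorem sum_neighbor_of_mem {M : Type*} [AddCommMonoid M] (f : V → M) {v : V} (hv : G.Adj u v) :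
    ∑ z ∈ G.neighborFinset v, f z = f u + (∑ z ∈ G.neighborFinset v ∩ G.neighborFinset u, f z +
      ∑ z ∈ G.neighborFinset v ∩ far G u, f z) := by
  have := sum_eq_near_add_far (G := G) (u := u) (fun z => if G.Adj v z then f z else 0)
  simp only [← Finset.sum_filter, hv.symm, if_true] at this
  convert this using 3
  · ext; simp
  · congr 1; ext; simp [and_comm]
  · congr 1; ext; simp [and_comm, and_assoc]

theorem sum_neighbor_of_far {M : Type*} [AddCommMonoid M] (f : V → M) {v : V} (hv : v ∈ far G u) :
    ∑ z ∈ G.neighborFinset v, f z = ∑ z ∈ G.neighborFinset v ∩ G.neighborFinset u, f z +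
      ∑ z ∈ G.neighborFinset v ∩ far G u, f z := by
  have := sum_eq_near_add_far (G := G) (u := u) (fun z => if G.Adj v z then f z else 0)
  have hv' : ¬ G.Adj v u := fun h => (mem_far.1 hv).2 h.symm
  simp only [← Finset.sum_filter, hv', if_false, zero_add] at this
  convert this using 2
  · ext; simp
  · congr 1; ext; simp [and_comm]
  · congr 1; ext; simp [and_comm, and_assoc]

theorem degree_of_mem {v : V} (hv : G.Adj u v) : G.degree v = 1 + (codeg G u v + farDeg G u v) := by
  have := sum_neighbor_of_mem (fun _ => 1) hv
  simpa [codeg, farDeg] using this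

theorem degree_of_far {v : V} (hv : v ∈ far G u) : G.degree v = codeg G u v + farDeg G u v := by
  have := sum_neighbor_of_far (fun _ => 1) hv
  simpa [codeg, farDeg] using this

theorem sum_neighbor_comm {R : Type*} [AddCommMonoid R] (S T : Finset V) (f : V → R) :
    ∑ v ∈ S, ∑ z ∈ G.neighborFinset v ∩ T, f z =
      ∑ z ∈ T, (G.neighborFinset z ∩ S).card • f z := by
  rw [Finset.sum_comm' (t' := T) (s' := fun z => G.neighborFinset z ∩ S)]
  · simp
  · intro v z
    simp [G.adj_comm v z]
    tauto

theorem sum_farDeg : ∑ v ∈ G.neighborFinset u, farDeg G u v = ∑ w ∈ far G u, codeg G u w := by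
  have := sum_neighbor_comm (G := G) (G.neighborFinset u) (far G u) (fun _ => 1)
  simpa [codeg, farDeg] using this

theorem two_mul_card_edges : 2 * G.edgeFinset.card = 2 * G.degree u +
    ∑ v ∈ G.neighborFinset u, codeg G u v + 2 * ∑ w ∈ far G u, codeg G u w +
      ∑ w ∈ far G u, farDeg G u w := by
  rw [← G.sum_degrees_eq_twice_card_edges, sum_eq_near_add_far (G := G) (u := u),
    Finset.sum_congr rfl (fun v hv => degree_of_mem ((G.mem_neighborFinset u v).1 hv)),
    Finset.sum_congr rfl (fun v hv => degree_of_far hv)]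
  simp only [Finset.sum_add_distrib, sum_farDeg]
  simp
  ring

/-- The contribution of a neighbour of `u` to the edge deficiency. -/
noncomputable def defect (G : SimpleGraph V) [DecidableRel G.Adj] (u : V) (x : V → ℝ) (v : V) : ℝ :=
  codeg G u v / 2 - (codeg G u v - 1) * x v

/-- The expansion of `m - (λ² - λ)` around a vertex at which an eigenvector has entry one. -/
theorem size_sub_eq {l : ℝ} {x : V → ℝ} (hx : ∀ v, l * x v = ∑ z ∈ G.neighborFinset v, x z)
    (hu : x u = 1) : (G.edgeFinset.card : ℝ) - (l ^ 2 - l) =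
      ∑ v ∈ G.neighborFinset u, defect G u x v + ∑ w ∈ far G u, codeg G u w * (1 - x w) +
        (∑ w ∈ far G u, (farDeg G u w : ℝ)) / 2 := by
  have h1 : l = ∑ v ∈ G.neighborFinset u, x v := by rw [← hx, hu, mul_one]
  have h2 : l ^ 2 = G.degree u + (∑ v ∈ G.neighborFinset u, codeg G u v * x v +
      ∑ v ∈ far G u, codeg G u v * x v) := by
    -- Two-step walks from `u`, regrouped by endpoint: `u` is reached `degree u` times, any other
    -- vertex once per common neighbour with `u`.
    calc l ^ 2 = ∑ v ∈ G.neighborFinset u, l * x v := by rw [← Finset.mul_sum, ← h1, sq]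
      _ = ∑ v ∈ G.neighborFinset u, ∑ z ∈ G.neighborFinset v ∩ Finset.univ, x z := by
        simp only [hx, Finset.inter_univ]
      _ = _ := by
        rw [sum_neighbor_comm, sum_eq_near_add_far (G := G) (u := u)]
        simp [codeg, hu]
  have h3 : (2 : ℝ) * G.edgeFinset.card = 2 * G.degree u +
      ∑ v ∈ G.neighborFinset u, (codeg G u v : ℝ) + 2 * ∑ w ∈ far G u, (codeg G u w : ℝ) +
      ∑ w ∈ far G u, (farDeg G u w : ℝ) := by
    exact_mod_cast two_mul_card_edges (G := G) (u := u)
  have h4 : ∑ v ∈ G.neighborFinset u, defect G u x v =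
      (∑ v ∈ G.neighborFinset u, (codeg G u v : ℝ)) / 2 -
        ∑ v ∈ G.neighborFinset u, codeg G u v * x v + ∑ v ∈ G.neighborFinset u, x v := by
    rw [Finset.sum_div, ← Finset.sum_sub_distrib, ← Finset.sum_add_distrib]
    exact Finset.sum_congr rfl fun v _ => by unfold defect; ring
  have h5 : ∑ w ∈ far G u, codeg G u w * (1 - x w) =
      ∑ w ∈ far G u, (codeg G u w : ℝ) - ∑ w ∈ far G u, codeg G u w * x w := by
    rw [← Finset.sum_sub_distrib]
    exact Finset.sum_congr rfl fun v _ => by ring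
  rw [h4, h5]
  linarith

/-- `S` is a union of components of the subgraph induced on the neighbours of `u`. -/
def ClosedNear (G : SimpleGraph V) (u : V) (S : Finset V) : Prop :=
  (∀ v ∈ S, G.Adj u v) ∧ ∀ v ∈ S, ∀ z, G.Adj u z → G.Adj v z → z ∈ S

omit [DecidableEq V] in
theorem closedNear_neighborFinset : ClosedNear G u (G.neighborFinset u) := by
  constructor <;> simp +contextual

omit [Fintype V] [DecidableRel G.Adj] in
theorem ClosedNear.sdiff {S T : Finset V} (hT : ClosedNear G u T) (hS : ClosedNear G u S) :
    ClosedNear G u (T \ S) := by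
  refine ⟨fun v hv => hT.1 v (Finset.mem_sdiff.1 hv).1, fun v hv z hz hvz => ?_⟩
  rw [Finset.mem_sdiff] at hv ⊢
  exact ⟨hT.2 v hv.1 z hz hvz, fun hzS => hv.2 (hS.2 z hzS v (hT.1 v hv.1) hvz.symm)⟩

theorem codeg_pos_of_adj {v z : V} (hz : G.Adj u z) (h : G.Adj v z) : 0 < codeg G u v :=
  Finset.card_pos.2 ⟨z, by simp [hz, h]⟩

omit [Fintype V] [DecidableRel G.Adj] in
-- A path on four vertices among the neighbours of `u` would close to a pentagon through `u`.
theorem NoPentagon.eq_of_path (h5 : NoPentagon G) {z v w y : V} (hz : G.Adj u z) (hv : G.Adj u v)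
    (hw : G.Adj u w) (hy : G.Adj u y) (h1 : G.Adj z v) (h2 : G.Adj v w) (h3 : G.Adj w y)
    (hzw : z ≠ w) (hyv : y ≠ v) : y = z := by
  by_contra h
  exact h5 u z v w y hz h1 h2 h3 hy.symm hv.ne hw.ne hzw (Ne.symm h) hyv.symm

/-- By `NoPentagon.eq_of_path`, any further neighbour of `v` and any further neighbour of `w`
coincide. So either one end of the edge is a leaf, or the edge lies in a triangle component. -/
theorem NoPentagon.codeg_of_adj (h5 : NoPentagon G) {v w : V} (hv : G.Adj u v) (hw : G.Adj u w)
    (h : G.Adj v w) : codeg G u v = 1 ∨ codeg G u w = 1 ∨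
      (codeg G u v = 2 ∧ codeg G u w = 2 ∧ ∃ z, G.Adj u z ∧ G.Adj v z ∧ G.Adj w z) := by
  by_cases h1 : ∃ z, G.Adj u z ∧ G.Adj v z ∧ z ≠ w
  · by_cases h2 : ∃ y, G.Adj u y ∧ G.Adj w y ∧ y ≠ v
    · obtain ⟨z, hz, hvz, hzw⟩ := h1
      obtain ⟨y, hy, hwy, hyv⟩ := h2
      have hall : ∀ z' y', G.Adj u z' → G.Adj v z' → z' ≠ w → G.Adj u y' → G.Adj w y' → y' ≠ v →
          y' = z' := fun z' y' a b c d e f => h5.eq_of_path a hv hw d b.symm h e c f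
      obtain rfl := hall z y hz hvz hzw hy hwy hyv
      refine Or.inr (Or.inr ⟨?_, ?_, y, hy, hvz, hwy⟩)
      · have : G.neighborFinset v ∩ G.neighborFinset u = {w, y} := by
          ext a
          simp only [Finset.mem_inter, SimpleGraph.mem_neighborFinset, Finset.mem_insert,
            Finset.mem_singleton]
          constructor
          · rintro ⟨ha, ha'⟩
            by_cases haw : a = w
            · exact Or.inl haw
            · exact Or.inr (hall a y ha' ha haw hy hwy hyv).symm
          · rintro (rfl | rfl)
            · exact ⟨h, hw⟩
            · exact ⟨hvz, hy⟩
        rw [codeg, this, Finset.card_pair hzw.symm]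
      · have : G.neighborFinset w ∩ G.neighborFinset u = {v, y} := by
          ext a
          simp only [Finset.mem_inter, SimpleGraph.mem_neighborFinset, Finset.mem_insert,
            Finset.mem_singleton]
          constructor
          · rintro ⟨ha, ha'⟩
            by_cases hav : a = v
            · exact Or.inl hav
            · exact Or.inr (hall y a hz hvz hzw ha' ha hav)
          · rintro (rfl | rfl)
            · exact ⟨h.symm, hv⟩
            · exact ⟨hwy, hy⟩
        rw [codeg, this, Finset.card_pair hyv.symm]
    · right; left
      push Not at h2
      rw [codeg, Finset.card_eq_one]
      refine ⟨v, ?_⟩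
      ext a
      simp only [Finset.mem_inter, SimpleGraph.mem_neighborFinset, Finset.mem_singleton]
      exact ⟨fun ha => h2 a ha.2 ha.1, fun ha => ha ▸ ⟨h.symm, hv⟩⟩
  · left
    push Not at h1
    rw [codeg, Finset.card_eq_one]
    refine ⟨w, ?_⟩
    ext a
    simp only [Finset.mem_inter, SimpleGraph.mem_neighborFinset, Finset.mem_singleton]
    exact ⟨fun ha => h1 a ha.2 ha.1, fun ha => ha ▸ ⟨h, hw⟩⟩

theorem NoPentagon.one_le_inv_codeg_add (h5 : NoPentagon G) {v w : V} (hv : G.Adj u v)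
    (hw : G.Adj u w) (h : G.Adj v w) : (1 : ℝ) ≤ (codeg G u v : ℝ)⁻¹ + (codeg G u w : ℝ)⁻¹ := by
  have p1 : (0 : ℝ) ≤ (codeg G u v : ℝ)⁻¹ := by positivity
  have p2 : (0 : ℝ) ≤ (codeg G u w : ℝ)⁻¹ := by positivity
  rcases h5.codeg_of_adj hv hw h with h1 | h1 | ⟨h1, h2, -⟩
  · rw [h1] at *; simp at *
  · rw [h1] at *; simp at *
  · rw [h1, h2]; norm_num

/-- Discharging: since `x v ≤ 1`, a vertex of positive codegree `d` has defect at least `1 - d/2`,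
that is `1/d - 1/2` for each of its edges. The two ends of an edge together receive at least `1 - 1
= 0`, by `NoPentagon.one_le_inv_codeg_add`. -/
theorem NoPentagon.sum_defect_nonneg (h5 : NoPentagon G) {x : V → ℝ} (hx0 : ∀ v, 0 ≤ x v)
    (hx1 : ∀ v, x v ≤ 1) {S : Finset V} (hS : ClosedNear G u S) :
    0 ≤ ∑ v ∈ S, defect G u x v := by
  set g : V → ℝ := fun v => (codeg G u v : ℝ)⁻¹ - 1 / 2 with hg
  have h1 : ∀ v ∈ S, ∑ z ∈ S, (if G.Adj v z then g v else 0) ≤ defect G u x v := by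
    intro v hv
    have hset : S.filter (G.Adj v) = G.neighborFinset v ∩ G.neighborFinset u := by
      ext z
      simp only [Finset.mem_filter, Finset.mem_inter, SimpleGraph.mem_neighborFinset]
      exact ⟨fun h => ⟨h.2, hS.1 z h.1⟩, fun h => ⟨hS.2 v hv z h.2 h.1, h.1⟩⟩
    rw [← Finset.sum_filter, hset, Finset.sum_const, nsmul_eq_mul]
    change (codeg G u v : ℝ) * ((codeg G u v : ℝ)⁻¹ - 1 / 2) ≤ _
    unfold defect
    rcases Nat.eq_zero_or_pos (codeg G u v) with h0 | hpos
    · rw [h0]; simpa using hx0 v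
    · have hc : (1 : ℝ) ≤ codeg G u v := by exact_mod_cast hpos
      have : (codeg G u v : ℝ) * (codeg G u v : ℝ)⁻¹ = 1 := mul_inv_cancel₀ (by positivity)
      nlinarith [hx1 v]
  refine le_trans ?_ (Finset.sum_le_sum h1)
  have h2 : ∑ v ∈ S, ∑ z ∈ S, (if G.Adj v z then g v else 0) =
      ∑ v ∈ S, ∑ z ∈ S, (if G.Adj v z then g z else 0) := by
    rw [Finset.sum_comm]
    simp only [G.adj_comm]
  have h3 : 0 ≤ ∑ v ∈ S, ∑ z ∈ S, (if G.Adj v z then g v + g z else 0) := by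
    refine Finset.sum_nonneg fun v hv => Finset.sum_nonneg fun z hz => ?_
    split_ifs with h
    · have := h5.one_le_inv_codeg_add (hS.1 v hv) (hS.1 z hz) h
      simp only [hg]
      linarith
    · rfl
  have h4 : ∑ v ∈ S, ∑ z ∈ S, (if G.Adj v z then g v + g z else 0) =
      ∑ v ∈ S, ∑ z ∈ S, (if G.Adj v z then g v else 0) +
      ∑ v ∈ S, ∑ z ∈ S, (if G.Adj v z then g z else 0) := by
    simp only [← Finset.sum_add_distrib]
    refine Finset.sum_congr rfl fun v _ => Finset.sum_congr rfl fun z _ => ?_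
    split_ifs <;> simp
  rw [h4, ← h2] at h3
  linarith

/-- Without triangles among the neighbours of `u`, a union of components of the graph they induce
that contains an edge contains a star component. -/
theorem NoPentagon.exists_star (h5 : NoPentagon G)
    (h3 : ∀ a b c, G.Adj u a → G.Adj u b → G.Adj u c → G.Adj a b → G.Adj b c → G.Adj a c → False)
    (x : V → ℝ) {T : Finset V} (hT : ClosedNear G u T) (hne : ∃ v ∈ T, 0 < codeg G u v) :
    ∃ c ∈ T, 0 < codeg G u c ∧ (∀ l, G.Adj u l → G.Adj c l → codeg G u l = 1) ∧
      insert c (G.neighborFinset c ∩ G.neighborFinset u) ⊆ T ∧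
      ClosedNear G u (insert c (G.neighborFinset c ∩ G.neighborFinset u)) ∧
      ∑ v ∈ T, defect G u x v = codeg G u c - (codeg G u c - 1) * x c +
        ∑ v ∈ T \ insert c (G.neighborFinset c ∩ G.neighborFinset u), defect G u x v := by
  obtain ⟨v₀, hv₀, hpos⟩ := hne
  -- Maximal codegree makes `c` a centre: if `c` itself has codegree 1, its neighbour has codegree 1
  -- as well and the star is a single edge.
  obtain ⟨c, hcT, hcmax⟩ := T.exists_max_image (codeg G u) ⟨v₀, hv₀⟩
  have hc0 : 0 < codeg G u c := hpos.trans_le (hcmax v₀ hv₀)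
  have hleaf : ∀ l, G.Adj u l → G.Adj c l → codeg G u l = 1 := by
    intro l hl hcl
    have hlT := hT.2 c hcT l hl hcl
    rcases h5.codeg_of_adj (hT.1 c hcT) hl hcl with h | h | ⟨-, -, z, hz, hcz, hlz⟩
    · have h1 := hcmax l hlT
      have h2 := codeg_pos_of_adj (hT.1 c hcT) hcl.symm
      omega
    · exact h
    · exact (h3 c l z (hT.1 c hcT) hl hz hcl hlz hcz).elim
  have hsub : insert c (G.neighborFinset c ∩ G.neighborFinset u) ⊆ T := by
    intro v hv
    simp only [Finset.mem_insert, Finset.mem_inter, SimpleGraph.mem_neighborFinset] at hv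
    rcases hv with rfl | ⟨h1, h2⟩
    · exact hcT
    · exact hT.2 c hcT v h2 h1
  refine ⟨c, hcT, hc0, hleaf, hsub, ⟨fun v hv => hT.1 v (hsub hv), ?_⟩, ?_⟩
  · intro v hv z hz hvz
    simp only [Finset.mem_insert, Finset.mem_inter, SimpleGraph.mem_neighborFinset] at hv ⊢
    rcases hv with rfl | ⟨h1, h2⟩
    · exact Or.inr ⟨hvz, hz⟩
    · left
      have := hleaf v h2 h1
      rw [codeg, Finset.card_eq_one] at this
      obtain ⟨a, ha⟩ := this
      have hz' : z ∈ G.neighborFinset v ∩ G.neighborFinset u := by simp [hz, hvz]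
      have hc' : c ∈ G.neighborFinset v ∩ G.neighborFinset u := by simp [hT.1 c hcT, h1.symm]
      rw [ha, Finset.mem_singleton] at hz' hc'
      rw [hz', hc']
  · rw [← Finset.sum_sdiff hsub, add_comm, Finset.sum_insert (by simp)]
    congr 1
    have : ∀ l ∈ G.neighborFinset c ∩ G.neighborFinset u, defect G u x l = 1 / 2 := by
      intro l hl
      simp only [Finset.mem_inter, SimpleGraph.mem_neighborFinset] at hl
      simp [defect, hleaf l hl.2 hl.1]
    rw [Finset.sum_congr rfl this, Finset.sum_const, nsmul_eq_mul]
    change defect G u x c + (codeg G u c : ℝ) * (1 / 2) = _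
    unfold defect
    ring

end Local

/-! ### From a small edge deficiency to a book with pendant edges -/

section Structure

variable {V : Type*} [Fintype V] [DecidableEq V] {G : SimpleGraph V} [DecidableRel G.Adj] {u : V}

theorem NoPentagon.near_of_triangle (h5 : NoPentagon G) {a b c : V} (ha : G.Adj u a)
    (hb : G.Adj u b) (hc : G.Adj u c) (hab : G.Adj a b) (hbc : G.Adj b c) (hac : G.Adj a c) :
    G.neighborFinset a ∩ G.neighborFinset u = {b, c} := by
  ext z
  simp only [Finset.mem_inter, SimpleGraph.mem_neighborFinset, Finset.mem_insert,
    Finset.mem_singleton]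
  constructor
  · rintro ⟨h1, h2⟩
    by_cases hzb : z = b
    · exact Or.inl hzb
    · exact Or.inr (h5.eq_of_path h2 ha hb hc h1.symm hab hbc hzb hac.ne').symm
  · rintro (rfl | rfl)
    · exact ⟨hab, hb⟩
    · exact ⟨hac, hc⟩

/-- If `w` had a second neighbour `z` near `u`, then `w`, `a`, a triangle vertex other than `a` and
`z`, `u`, `z` would form a pentagon. -/
theorem NoPentagon.codeg_far_of_triangle (h5 : NoPentagon G) {a b c w : V} (ha : G.Adj u a)
    (hb : G.Adj u b) (hc : G.Adj u c) (hab : G.Adj a b) (hbc : G.Adj b c) (hac : G.Adj a c)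
    (hw : w ∈ far G u) (hwa : G.Adj w a) : codeg G u w = 1 := by
  rw [mem_far] at hw
  have key : ∀ z b', G.Adj u z → G.Adj w z → z ≠ a → G.Adj u b' → G.Adj a b' → b' ≠ z → False := by
    intro z b' hz hwz hza hb' hab' hbz
    exact h5 w a b' u z hwa hab' hb'.symm hz hwz.symm (fun h => hw.2 (h ▸ hb')) hw.1 ha.ne'
      hza.symm hbz
  rw [codeg, Finset.card_eq_one]
  refine ⟨a, ?_⟩
  ext z
  simp only [Finset.mem_inter, SimpleGraph.mem_neighborFinset, Finset.mem_singleton]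
  constructor
  · rintro ⟨h1, h2⟩
    by_contra hza
    by_cases hbz : b = z
    · exact key z c h2 h1 hza hc hac (hbz ▸ hbc.ne')
    · exact key z b h2 h1 hza hb hab hbz
  · rintro rfl
    exact ⟨hwa, ha⟩

/-- Each far neighbour of `w` has `w` as a far neighbour, so together they contribute `farDeg G u w`
again. -/
theorem two_mul_farDeg_le {w : V} (hw : w ∈ far G u) :
    2 * farDeg G u w ≤ ∑ z ∈ far G u, farDeg G u z := by
  have hsub : insert w (G.neighborFinset w ∩ far G u) ⊆ far G u := by
    intro z hz
    rcases Finset.mem_insert.1 hz with rfl | hz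
    · exact hw
    · exact (Finset.mem_inter.1 hz).2
  refine le_trans ?_ (Finset.sum_le_sum_of_subset hsub)
  rw [Finset.sum_insert (by simp), two_mul]
  gcongr
  rw [farDeg, Finset.card_eq_sum_ones]
  refine Finset.sum_le_sum fun z hz => ?_
  rw [Finset.mem_inter, SimpleGraph.mem_neighborFinset] at hz
  exact Finset.card_pos.2 ⟨w, by rw [Finset.mem_inter, SimpleGraph.mem_neighborFinset]
                                 exact ⟨hz.1.symm, hw⟩⟩

variable {l : ℝ} {x : V → ℝ}

omit [DecidableEq V] in
theorem mul_le_degree (hx : ∀ v, l * x v = ∑ z ∈ G.neighborFinset v, x z) (hx1 : ∀ v, x v ≤ 1)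
    (v : V) : l * x v ≤ G.degree v := by
  rw [hx, ← SimpleGraph.card_neighborFinset_eq_degree, Finset.card_eq_sum_ones]
  push_cast
  exact Finset.sum_le_sum fun z _ => hx1 z

/-- The triangle has defect `3 - (x a + x b + x c)`, small only if its entries are large. That
requires many edges to far vertices; such a far vertex has degree at most 2, hence a small entry,
and so costs more than it gains. -/
theorem NoPentagon.two_le_of_triangle (h5 : NoPentagon G)
    (hx : ∀ v, l * x v = ∑ z ∈ G.neighborFinset v, x z) (hx0 : ∀ v, 0 ≤ x v) (hx1 : ∀ v, x v ≤ 1)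
    (hu : x u = 1) (hl : 5 < l) (hfar : ∀ w ∈ far G u, farDeg G u w ≤ 1) {a b c : V}
    (ha : G.Adj u a) (hb : G.Adj u b) (hc : G.Adj u c) (hab : G.Adj a b) (hbc : G.Adj b c)
    (hac : G.Adj a c) : 2 ≤ ∑ v ∈ G.neighborFinset u, defect G u x v +
      ∑ w ∈ far G u, codeg G u w * (1 - x w) := by
  have na := h5.near_of_triangle ha hb hc hab hbc hac
  have nb := h5.near_of_triangle hb ha hc hab.symm hac hbc
  have nc := h5.near_of_triangle hc ha hb hac.symm hab hbc.symm
  set S : Finset V := {a, b, c} with hS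
  have sumS : ∀ f : V → ℝ, ∑ v ∈ S, f v = f a + f b + f c := by
    intro f
    rw [hS, Finset.sum_insert (by simp [hab.ne, hac.ne]), Finset.sum_pair hbc.ne, add_assoc]
  have memS : ∀ {v}, v ∈ S ↔ v = a ∨ v = b ∨ v = c := by intro v; simp [hS]
  have hclosed : ClosedNear G u S := by
    refine ⟨?_, ?_⟩
    · intro v hv
      rcases memS.1 hv with rfl | rfl | rfl <;> assumption
    · intro v hv z hz hvz
      have hmem : z ∈ G.neighborFinset v ∩ G.neighborFinset u := by simp [hz, hvz]
      rw [memS]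
      rcases memS.1 hv with rfl | rfl | rfl
      · rw [na] at hmem; simp at hmem; tauto
      · rw [nb] at hmem; simp at hmem; tauto
      · rw [nc] at hmem; simp at hmem; tauto
  have hdef : ∑ v ∈ S, defect G u x v = 3 - (x a + x b + x c) := by
    rw [sumS]
    simp only [defect, codeg, na, nb, nc, Finset.card_pair hbc.ne, Finset.card_pair hac.ne,
      Finset.card_pair hab.ne]
    push_cast
    ring
  have hsplit : ∑ v ∈ S, defect G u x v ≤ ∑ v ∈ G.neighborFinset u, defect G u x v := by
    have hsub : S ⊆ G.neighborFinset u := fun v hv => by simpa using hclosed.1 v hv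
    rw [← Finset.sum_sdiff hsub]
    have := h5.sum_defect_nonneg hx0 hx1 (closedNear_neighborFinset.sdiff hclosed)
    linarith
  set τ : V → ℝ := fun w => ((G.neighborFinset w ∩ S).card : ℝ) with hτ
  have hsum : l * (x a + x b + x c) = 3 + 2 * (x a + x b + x c) + ∑ w ∈ far G u, τ w * x w := by
    have h1 : ∑ v ∈ S, ∑ z ∈ G.neighborFinset v ∩ far G u, x z = ∑ w ∈ far G u, τ w * x w := by
      rw [sum_neighbor_comm]; simp [hτ]
    rw [← h1, sumS, mul_add, mul_add, hx a, hx b, hx c, sum_neighbor_of_mem x ha,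
      sum_neighbor_of_mem x hb, sum_neighbor_of_mem x hc, na, nb, nc, Finset.sum_pair hbc.ne,
      Finset.sum_pair hac.ne, Finset.sum_pair hab.ne, hu]
    ring
  have hw : ∀ w ∈ far G u, τ w * x w ≤ τ w * (2 / l) ∧
      τ w * (1 - 2 / l) ≤ codeg G u w * (1 - x w) := by
    intro w hw
    rcases (G.neighborFinset w ∩ S).eq_empty_or_nonempty with he | ⟨v, hv⟩
    · have : τ w = 0 := by simp [hτ, he]
      rw [this]
      refine ⟨by simp, ?_⟩
      rw [zero_mul]
      exact mul_nonneg (Nat.cast_nonneg _) (by linarith [hx1 w])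
    · rw [Finset.mem_inter, SimpleGraph.mem_neighborFinset, memS] at hv
      have hc1 : codeg G u w = 1 := by
        rcases hv with ⟨h, rfl | rfl | rfl⟩
        · exact h5.codeg_far_of_triangle ha hb hc hab hbc hac hw h
        · exact h5.codeg_far_of_triangle hb ha hc hab.symm hac hbc hw h
        · exact h5.codeg_far_of_triangle hc ha hb hac.symm hab hbc.symm hw h
      have hxw : x w ≤ 2 / l := by
        rw [le_div_iff₀ (by linarith), mul_comm]
        refine (mul_le_degree hx hx1 w).trans ?_
        rw [degree_of_far hw, hc1]
        have := hfar w hw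
        exact_mod_cast (by omega : 1 + farDeg G u w ≤ 2)
      have hτ1 : τ w ≤ codeg G u w := by
        have : (G.neighborFinset w ∩ S).card ≤ codeg G u w :=
          Finset.card_le_card (Finset.inter_subset_inter_left
            (fun v hv => by simpa using hclosed.1 v hv))
        simp only [hτ]
        exact_mod_cast this
      exact ⟨mul_le_mul_of_nonneg_left hxw (Nat.cast_nonneg _),
        mul_le_mul hτ1 (by linarith)
          (by rw [sub_nonneg, div_le_one (by linarith)]; linarith) (Nat.cast_nonneg _)⟩
  have hn0 : 0 ≤ ∑ w ∈ far G u, τ w := Finset.sum_nonneg fun w _ => Nat.cast_nonneg _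
  have e1 : ∑ w ∈ far G u, τ w * x w ≤ (∑ w ∈ far G u, τ w) * (2 / l) := by
    rw [Finset.sum_mul]; exact Finset.sum_le_sum fun w h => (hw w h).1
  have e2 : (∑ w ∈ far G u, τ w) * (1 - 2 / l) ≤ ∑ w ∈ far G u, codeg G u w * (1 - x w) := by
    rw [Finset.sum_mul]; exact Finset.sum_le_sum fun w h => (hw w h).2
  set n := ∑ w ∈ far G u, τ w
  have h2l : 2 / l ≤ 2 / 5 := by gcongr
  have e3 : n * (2 / l) ≤ n * (2 / 5) := mul_le_mul_of_nonneg_left h2l hn0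
  -- With `σ = x a + x b + x c`, the bounds give `(l - 2)σ ≤ 3 + 2n/5`, so `σ ≤ 1 + 2n/15` as `l >
  -- 5`. The far vertices contribute at least `3n/5`, and `3 - σ + 3n/5 ≥ 2 + 7n/15`.
  by_contra hcon
  nlinarith

theorem defect_eq_of_codeg_eq_zero {v : V} (h : codeg G u v = 0) : defect G u x v = x v := by
  simp [defect, h]

theorem star_le {r y : ℝ} (hr : 1 ≤ r) (hy : y ≤ 1) : 1 ≤ r - (r - 1) * y := by nlinarith

theorem sum_star_split {M : Type*} [AddCommMonoid M] {c : V} (hc : G.Adj u c) (f : V → M) :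
    ∑ v ∈ G.neighborFinset u, f v = ∑ v ∈ G.neighborFinset u \
        insert c (G.neighborFinset c ∩ G.neighborFinset u), f v +
      (f c + ∑ v ∈ G.neighborFinset c ∩ G.neighborFinset u, f v) := by
  rw [← Finset.sum_insert (by simp), Finset.sum_sdiff]
  intro v hv
  rcases Finset.mem_insert.1 hv with rfl | h
  · simpa using hc
  · exact (Finset.mem_inter.1 h).2

theorem star_size {c : V} (hc : G.Adj u c)
    (hleaf : ∀ v, G.Adj u v → G.Adj c v → codeg G u v = 1)
    (hrest : ∀ v ∈ G.neighborFinset u \ insert c (G.neighborFinset c ∩ G.neighborFinset u),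
      codeg G u v = 0) :
    2 * G.edgeFinset.card = 2 * (1 + 2 * codeg G u c + (G.neighborFinset u \
      insert c (G.neighborFinset c ∩ G.neighborFinset u)).card) +
      2 * ∑ w ∈ far G u, codeg G u w + ∑ w ∈ far G u, farDeg G u w := by
  have h1 := sum_star_split hc (fun _ => 1)
  have h2 := sum_star_split hc (codeg G u)
  have h3 : ∑ v ∈ G.neighborFinset c ∩ G.neighborFinset u, codeg G u v =
      ∑ v ∈ G.neighborFinset c ∩ G.neighborFinset u, 1 := by
    refine Finset.sum_congr rfl fun v hv => ?_
    rw [Finset.mem_inter, SimpleGraph.mem_neighborFinset, SimpleGraph.mem_neighborFinset] at hv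
    exact hleaf v hv.2 hv.1
  rw [Finset.sum_eq_zero hrest, h3] at h2
  simp only [Finset.sum_const, smul_eq_mul, mul_one] at h1 h2
  rw [SimpleGraph.card_neighborFinset_eq_degree] at h1
  change _ = _ + (_ + codeg G u c) at h1
  change _ = _ + (_ + codeg G u c) at h2
  rw [two_mul_card_edges (u := u), h2, h1]
  ring

/-- A pentagon-free graph whose spectral radius is large is a book with pendant edges at one vertex
of its spine. -/
theorem NoPentagon.exists_spine (h5 : NoPentagon G) (hiso : ∀ v, ¬ G.IsIsolated v)
    (hx : ∀ v, l * x v = ∑ z ∈ G.neighborFinset v, x z) (hx0 : ∀ v, 0 ≤ x v) (hx1 : ∀ v, x v ≤ 1)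
    (hu : x u = 1) (hl : 5 < l) {k t : ℕ} (ht : t = 1 ∨ t = 2)
    (hm : G.edgeFinset.card = 2 * k + t + 1) (hlk : 2 * (k : ℝ) + t / 2 < l ^ 2 - l) :
    ∃ c, G.Adj u c ∧ far G u = ∅ ∧ (∀ v, G.Adj u v → G.Adj c v → codeg G u v = 1) ∧
      (∀ v ∈ G.neighborFinset u \ insert c (G.neighborFinset c ∩ G.neighborFinset u),
        codeg G u v = 0) ∧ 0 < codeg G u c := by
  have ht2 : (t : ℝ) ≤ 2 := by rcases ht with rfl | rfl <;> norm_num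
  -- The budget: each excluded configuration below is one that overspends `1 + t/2 ≤ 2`.
  have hI : ∑ v ∈ G.neighborFinset u, defect G u x v + ∑ w ∈ far G u, codeg G u w * (1 - x w) +
      (∑ w ∈ far G u, (farDeg G u w : ℝ)) / 2 < 1 + t / 2 := by
    rw [← size_sub_eq hx hu, hm]
    push_cast
    linarith
  have hWt : ∀ w ∈ far G u, 0 ≤ codeg G u w * (1 - x w) := fun w _ =>
    mul_nonneg (Nat.cast_nonneg _) (by linarith [hx1 w])
  have hW := Finset.sum_nonneg hWt
  have hN := h5.sum_defect_nonneg hx0 hx1 (closedNear_neighborFinset (G := G) (u := u))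
  have hE0 : (0 : ℝ) ≤ ∑ w ∈ far G u, (farDeg G u w : ℝ) :=
    Finset.sum_nonneg fun _ _ => Nat.cast_nonneg _
  have hE : ∑ w ∈ far G u, farDeg G u w < 4 := by
    have : (∑ w ∈ far G u, (farDeg G u w : ℝ)) < 4 := by linarith
    exact_mod_cast this
  have h3 : ∀ a b c, G.Adj u a → G.Adj u b → G.Adj u c → G.Adj a b → G.Adj b c → G.Adj a c →
      False := by
    intro a b c ha hb hc hab hbc hac
    have := h5.two_le_of_triangle hx hx0 hx1 hu hl (fun w hw => by
      have := two_mul_farDeg_le hw; omega) ha hb hc hab hbc hac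
    linarith
  have hlsum : l = ∑ v ∈ G.neighborFinset u, x v := by rw [← hx, hu, mul_one]
  have hedge : ∃ v ∈ G.neighborFinset u, 0 < codeg G u v := by
    by_contra hno
    push Not at hno
    rw [Finset.sum_congr rfl
      fun v hv => defect_eq_of_codeg_eq_zero (x := x) (Nat.le_zero.1 (hno v hv)), ← hlsum] at hI
    linarith
  obtain ⟨c, hcN, hr, hleaf, -, hclosed, hsum⟩ :=
    h5.exists_star h3 x closedNear_neighborFinset hedge
  have hc : G.Adj u c := by simpa using hcN
  set L := G.neighborFinset c ∩ G.neighborFinset u with hL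
  set U := G.neighborFinset u \ insert c L with hU
  have hUc : ClosedNear G u U := closedNear_neighborFinset.sdiff hclosed
  have hstar : 1 ≤ (codeg G u c : ℝ) - (codeg G u c - 1) * x c :=
    star_le (by exact_mod_cast hr) (hx1 c)
  have hrest : ∀ v ∈ U, codeg G u v = 0 := by
    by_contra hno
    push Not at hno
    obtain ⟨v, hv, hv0⟩ := hno
    obtain ⟨c', -, hr', -, -, hclosed', hsum'⟩ :=
      h5.exists_star h3 x hUc ⟨v, hv, Nat.pos_of_ne_zero hv0⟩
    have hstar' : 1 ≤ (codeg G u c' : ℝ) - (codeg G u c' - 1) * x c' :=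
      star_le (by exact_mod_cast hr') (hx1 c')
    have := h5.sum_defect_nonneg hx0 hx1 (hUc.sdiff hclosed')
    linarith
  rw [Finset.sum_congr rfl fun v hv => defect_eq_of_codeg_eq_zero (x := x) (hrest v hv)] at hsum
  have hUx : 0 ≤ ∑ v ∈ U, x v := Finset.sum_nonneg fun v _ => hx0 v
  have hfd : ∀ w ∈ far G u, farDeg G u w = 0 := by
    intro w hw
    by_contra h
    have h2 : 2 ≤ ∑ w ∈ far G u, farDeg G u w := by
      have := two_mul_farDeg_le hw; omega
    have : (2 : ℝ) ≤ ∑ w ∈ far G u, (farDeg G u w : ℝ) := by exact_mod_cast h2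
    linarith
  -- The star has used up 1 of the budget; `t/2` remains.
  have hII : ∑ v ∈ U, x v + ∑ w ∈ far G u, codeg G u w * (1 - x w) < t / 2 := by linarith
  have hr2 : 3 < codeg G u c := by
    have h1 := sum_star_split hc x
    have h2 : ∑ v ∈ L, x v ≤ codeg G u c := by
      change _ ≤ (L.card : ℝ)
      rw [Finset.card_eq_sum_ones]; push_cast
      exact Finset.sum_le_sum fun v _ => hx1 v
    have h3 : (3 : ℝ) < codeg G u c := by linarith [hx1 c]
    exact_mod_cast h3
  have hxfar : ∀ w ∈ far G u, l * x w = ∑ z ∈ G.neighborFinset w ∩ G.neighborFinset u, x z := by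
    intro w hw
    have : G.neighborFinset w ∩ far G u = ∅ := Finset.card_eq_zero.1 (hfd w hw)
    rw [hx, sum_neighbor_of_far x hw, this, Finset.sum_empty, add_zero]
  have hcod : ∀ w ∈ far G u, 1 ≤ codeg G u w := by
    intro w hw
    have h1 := degree_of_far hw
    rw [hfd w hw, add_zero] at h1
    have h2 : 0 < G.degree w := by
      have := hiso w
      rw [SimpleGraph.IsIsolated] at this
      push Not at this
      rw [G.degree_pos_iff_exists_adj]
      exact this
    omega
  have hterm : ∀ w ∈ far G u, 1 - x w ≤ codeg G u w * (1 - x w) := fun w hw =>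
    le_mul_of_one_le_left (by linarith [hx1 w]) (by exact_mod_cast hcod w hw)
  have hsingle : ∀ w ∈ far G u, 1 - x w ≤ ∑ w ∈ far G u, codeg G u w * (1 - x w) := fun w hw =>
    (hterm w hw).trans (Finset.single_le_sum hWt hw)
  have memL : ∀ {v}, v ∈ L ↔ G.Adj c v ∧ G.Adj u v := by intro v; simp [hL]
  have memU : ∀ {v}, v ∈ U ↔ G.Adj u v ∧ v ≠ c ∧ v ∉ L := by intro v; simp [hU]
  have hLcard : 3 < L.card := hr2
  -- If `w` has a neighbour in `U`, a neighbour of `w` in the star would close a pentagon, so `l * x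
  -- w` is at most the sum of `x` over `U`. The remaining budget, at most 1, makes that sum less
  -- than `x w`, which is impossible for `l > 5`.
  have hnoU : ∀ w ∈ far G u, ∀ v ∈ U, ¬ G.Adj w v := by
    intro w hw v hv hwv
    have hwf := mem_far.1 hw
    have hvU := memU.1 hv
    have hsub : G.neighborFinset w ∩ G.neighborFinset u ⊆ U := by
      intro z hz
      rw [Finset.mem_inter, SimpleGraph.mem_neighborFinset, SimpleGraph.mem_neighborFinset] at hz
      rw [memU]
      refine ⟨hz.2, ?_, ?_⟩
      · rintro rfl
        obtain ⟨a, ha⟩ := Finset.card_pos.1 (by omega : 0 < L.card)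
        have ha' := memL.1 ha
        exact h5 w z a u v hz.1 ha'.1 ha'.2.symm hvU.1 hwv.symm
          (fun h => hwf.2 (h ▸ ha'.2)) hwf.1 hc.ne' hvU.2.1.symm (fun h => hvU.2.2 (h ▸ ha))
      · intro hzL
        have hz' := memL.1 hzL
        exact h5 w z c u v hz.1 hz'.1.symm hc.symm hvU.1 hwv.symm
          (fun h => hwf.2 (h ▸ hc)) hwf.1 hz.2.ne' (fun h => hvU.2.2 (h ▸ hzL)) hvU.2.1.symm
    have h1 : l * x w ≤ ∑ v ∈ U, x v := by
      rw [hxfar w hw]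
      exact Finset.sum_le_sum_of_subset_of_nonneg hsub fun i _ _ => hx0 i
    have h2 := hsingle w hw
    nlinarith [hx0 w]
  have hcod1 : ∀ w ∈ far G u, codeg G u w = 1 := by
    intro w hw
    have hwf := mem_far.1 hw
    refine le_antisymm (Finset.card_le_one.2 ?_) (hcod w hw)
    have hcL : ∀ a ∈ L, G.Adj w c → G.Adj w a → False := by
      intro a ha hwc hwa
      obtain ⟨b, hb, hba⟩ := Finset.exists_mem_ne (by omega : 1 < L.card) a
      have ha' := memL.1 ha
      have hb' := memL.1 hb
      exact h5 w c b u a hwc hb'.1 hb'.2.symm ha'.2 hwa.symm (fun h => hwf.2 (h ▸ hb'.2)) hwf.1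
        hc.ne' ha'.1.ne hba
    have hin : ∀ z ∈ G.neighborFinset w ∩ G.neighborFinset u, G.Adj w z ∧ (z = c ∨ z ∈ L) := by
      intro z hz
      rw [Finset.mem_inter, SimpleGraph.mem_neighborFinset, SimpleGraph.mem_neighborFinset] at hz
      refine ⟨hz.1, ?_⟩
      by_contra hcon
      push Not at hcon
      exact hnoU w hw z (memU.2 ⟨hz.2, hcon.1, hcon.2⟩) hz.1
    intro a ha b hb
    obtain ⟨hwa, ha⟩ := hin a ha
    obtain ⟨hwb, hb⟩ := hin b hb
    rcases ha with rfl | ha <;> rcases hb with rfl | hb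
    · rfl
    · exact (hcL b hb hwa hwb).elim
    · exact (hcL a ha hwb hwa).elim
    · by_contra hab
      have ha' := memL.1 ha
      have hb' := memL.1 hb
      exact h5 w a c u b hwa ha'.1.symm hc.symm hb'.2 hwb.symm (fun h => hwf.2 (h ▸ hc)) hwf.1
        ha'.2.ne' hab hb'.1.ne
  have hxw : ∀ w ∈ far G u, l * x w ≤ 1 := by
    intro w hw
    have := mul_le_degree hx hx1 w
    rwa [degree_of_far hw, hcod1 w hw, hfd w hw, add_zero, Nat.cast_one] at this
  have hxw' : ∀ w ∈ far G u, x w ≤ 1 / 5 := fun w hw => by nlinarith [hxw w hw, hx0 w]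
  refine ⟨c, hc, ?_, hleaf, hrest, hr⟩
  rw [Finset.eq_empty_iff_forall_notMem]
  intro w hw
  have hsw := hsingle w hw
  have hxw1 := hxw' w hw
  -- One far vertex costs at least `4/5`: too much for a budget of `1/2`. Two of them exceed even a
  -- budget of 1.
  have ht' : t = 2 := by
    rcases ht with rfl | rfl
    · push_cast at hII; linarith
    · rfl
  subst ht'
  have hfar1 : (far G u).card = 1 := by
    refine le_antisymm (Finset.card_le_one.2 ?_) (Finset.card_pos.2 ⟨w, hw⟩)
    intro a ha b hb
    by_contra hab
    have h1 : ∑ z ∈ ({a, b} : Finset V), codeg G u z * (1 - x z) ≤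
        ∑ w ∈ far G u, codeg G u w * (1 - x w) := by
      refine Finset.sum_le_sum_of_subset_of_nonneg ?_ fun i hi _ => hWt i hi
      intro z hz
      rcases Finset.mem_insert.1 hz with rfl | hz
      · exact ha
      · rwa [Finset.mem_singleton.1 hz]
    rw [Finset.sum_pair hab] at h1
    have := hterm a ha
    have := hterm b hb
    have := hxw' a ha
    have := hxw' b hb
    push_cast at hII
    linarith
  have hsize := star_size hc hleaf hrest
  rw [Finset.sum_congr rfl hcod1, Finset.sum_congr rfl hfd, hm] at hsize
  simp only [Finset.sum_const, hfar1, smul_eq_mul, mul_one, mul_zero, add_zero] at hsize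
  -- The single far vertex accounts for one edge, so `U.card` is odd. A vertex `v` of `U` has `x v ≥
  -- 1/l ≥ x w`, hence `x v + (1 - x w) ≥ 1`, the whole remaining budget.
  have hUpos : 0 < U.card := by
    change _ = 2 * (1 + 2 * codeg G u c + U.card) + 2 at hsize
    omega
  obtain ⟨v, hv⟩ := Finset.card_pos.1 hUpos
  have h1 : 1 ≤ l * x v := by
    rw [hx, ← hu]
    exact Finset.single_le_sum (f := x) (fun i _ => hx0 i) (by simpa using (memU.1 hv).1.symm)
  have h2 : x v ≤ ∑ v ∈ U, x v := Finset.single_le_sum (f := x) (fun i _ => hx0 i) hv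
  have h3 : x w ≤ x v := by
    have := hxw w hw
    by_contra hcon
    nlinarith
  push_cast at hII
  linarith

end Structure

/-! ### Books with pendant edges: eigenvalue, isomorphism type, extremality -/

section Extremal

variable {V : Type*} [Fintype V] [DecidableEq V] {G : SimpleGraph V} [DecidableRel G.Adj]

/-- `G` is a book with spine `uc`, page vertices `L`, and pendant vertices `U` attached to `u`. -/
structure IsPendantBook (G : SimpleGraph V) (u c : V) (L U : Finset V) : Prop where
  cover : ∀ v, v = u ∨ v = c ∨ v ∈ L ∨ v ∈ U
  spine_ne : c ≠ u
  disjoint : Disjoint L U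
  spine_notMem_left : c ∉ L
  spine_notMem_right : c ∉ U
  adj_base : ∀ v, G.Adj u v ↔ v ≠ u
  adj_spine : ∀ v, G.Adj c v ↔ v = u ∨ v ∈ L
  adj_page : ∀ a ∈ L, ∀ v, G.Adj a v ↔ v = u ∨ v = c
  adj_pendant : ∀ a ∈ U, ∀ v, G.Adj a v ↔ v = u

theorem isPendantBook_of_spine {u c : V} (hc : G.Adj u c) (hfar : far G u = ∅)
    (hleaf : ∀ v, G.Adj u v → G.Adj c v → codeg G u v = 1)
    (hrest : ∀ v ∈ G.neighborFinset u \ insert c (G.neighborFinset c ∩ G.neighborFinset u),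
      codeg G u v = 0) :
    IsPendantBook G u c (G.neighborFinset c ∩ G.neighborFinset u)
      (G.neighborFinset u \ insert c (G.neighborFinset c ∩ G.neighborFinset u)) := by
  have hu : ∀ v, G.Adj u v ↔ v ≠ u := by
    intro v
    refine ⟨fun h => h.ne', fun h => ?_⟩
    by_contra hcon
    have : v ∈ far G u := mem_far.2 ⟨h, hcon⟩
    simp [hfar] at this
  refine ⟨?_, hc.ne', ?_, by simp, by simp, hu, ?_, ?_, ?_⟩
  · intro v
    simp only [Finset.mem_inter, Finset.mem_sdiff, Finset.mem_insert,
      SimpleGraph.mem_neighborFinset, hu]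
    tauto
  · exact (Finset.disjoint_sdiff.mono_left (Finset.subset_insert _ _))
  · intro v
    simp only [Finset.mem_inter, SimpleGraph.mem_neighborFinset, hu]
    constructor
    · intro h
      by_cases hv : v = u
      · exact Or.inl hv
      · exact Or.inr ⟨h, hv⟩
    · rintro (rfl | h)
      · exact hc.symm
      · exact h.1
  · intro a ha v
    rw [Finset.mem_inter, SimpleGraph.mem_neighborFinset, SimpleGraph.mem_neighborFinset] at ha
    constructor
    · intro h
      by_cases hv : v = u
      · exact Or.inl hv
      · right
        exact Finset.card_le_one.1 (hleaf a ha.2 ha.1).le v (by simp [h, hu, hv]) c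
          (by simp [ha.1.symm, hc])
    · rintro (rfl | rfl)
      · exact ha.2.symm
      · exact ha.1.symm
  · intro a ha v
    have h0 := hrest a ha
    have hau : G.Adj u a := by simpa using (Finset.mem_sdiff.1 ha).1
    refine ⟨fun h => ?_, fun h => h ▸ hau.symm⟩
    by_contra hv
    have : v ∈ G.neighborFinset a ∩ G.neighborFinset u := by simp [h, hu, hv]
    rw [Finset.card_eq_zero.1 h0] at this
    simp at this

namespace IsPendantBook

variable {u c : V} {L U : Finset V}

omit [Fintype V] [DecidableEq V] [DecidableRel G.Adj] in
theorem base_notMem_left (h : IsPendantBook G u c L U) : u ∉ L := fun hu =>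
  G.loopless.irrefl u ((h.adj_page u hu u).2 (Or.inl rfl))

omit [Fintype V] [DecidableEq V] [DecidableRel G.Adj] in
theorem base_notMem_right (h : IsPendantBook G u c L U) : u ∉ U := fun hu =>
  G.loopless.irrefl u ((h.adj_pendant u hu u).2 rfl)

/-- The eigenvalue equations, summed over the classes `{u}`, `{c}`, `L`, `U`, form a linear system;
eliminating `x c` and the two class sums leaves the quartic. -/
theorem bookQuartic_eq_zero (h : IsPendantBook G u c L U) {l : ℝ} {x : V → ℝ}
    (hx : ∀ v, l * x v = ∑ z ∈ G.neighborFinset v, x z) (hu : x u = 1) :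
    bookQuartic L.card U.card l = 0 := by
  have e1 : l = x c + (∑ v ∈ L, x v + ∑ v ∈ U, x v) := by
    have : G.neighborFinset u = insert c (L ∪ U) := by
      ext v
      have := h.cover v
      have h1 := h.base_notMem_left
      have h2 := h.base_notMem_right
      simp only [SimpleGraph.mem_neighborFinset, h.adj_base, Finset.mem_insert, Finset.mem_union]
      constructor
      · tauto
      · rintro h' rfl
        have := h.spine_ne.symm
        tauto
    rw [← Finset.sum_union h.disjoint, ← Finset.sum_insert, ← this, ← hx, hu, mul_one]
    simp [h.spine_notMem_left, h.spine_notMem_right]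
  have e2 : l * x c = 1 + ∑ v ∈ L, x v := by
    have : G.neighborFinset c = insert u L := by ext v; simp [h.adj_spine]
    rw [hx, this, Finset.sum_insert h.base_notMem_left, hu]
  have e3 : l * ∑ v ∈ L, x v = L.card * (1 + x c) := by
    rw [Finset.mul_sum, ← nsmul_eq_mul, ← Finset.sum_const]
    refine Finset.sum_congr rfl fun a ha => ?_
    have : G.neighborFinset a = {u, c} := by ext v; simp [h.adj_page a ha]
    rw [hx, this, Finset.sum_pair h.spine_ne.symm, hu]
  have e4 : l * ∑ v ∈ U, x v = U.card := by
    rw [Finset.mul_sum, Finset.card_eq_sum_ones, Nat.cast_sum]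
    refine Finset.sum_congr rfl fun a ha => ?_
    have : G.neighborFinset a = {u} := by ext v; simp [h.adj_pendant a ha]
    rw [hx, this, Finset.sum_singleton, hu, Nat.cast_one]
  set P := ∑ v ∈ L, x v
  set Q := ∑ v ∈ U, x v
  set r := (L.card : ℝ)
  set s := (U.card : ℝ)
  have e5 : l ^ 2 = (1 + P) + r * (1 + x c) + s := by
    linear_combination l * e1 + e2 + e3 + e4
  have e6 : l * (l ^ 2 - 1 - r - s) = r * (2 + l - Q) := by
    linear_combination l * e5 + e3 + r * e2 - r * e1
  unfold bookQuartic
  linear_combination l * e6 - r * e4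

omit [Fintype V] [DecidableEq V] [DecidableRel G.Adj] in
theorem nonempty_iso_splitPendant (h : IsPendantBook G u c L U) {n t : ℕ}
    (hL : L.card = n - t - 2) (hU : U.card = t) : Nonempty (G ≃g splitPendant n 2 t) := by
  let eL := L.equivFinOfCardEq hL
  let eU := U.equivFinOfCardEq hU
  let f : (Fin 2 ⊕ Fin (n - t - 2)) ⊕ Fin t → V :=
    Sum.elim (Sum.elim ![u, c] fun i => (eL.symm i : V)) fun i => (eU.symm i : V)
  have hLm : ∀ i, (eL.symm i : V) ∈ L := fun i => (eL.symm i).2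
  have hUm : ∀ i, (eU.symm i : V) ∈ U := fun i => (eU.symm i).2
  have n1 : ∀ i, (eL.symm i : V) ≠ u := fun i hi => h.base_notMem_left (hi ▸ hLm i)
  have n2 : ∀ i, (eL.symm i : V) ≠ c := fun i hi => h.spine_notMem_left (hi ▸ hLm i)
  have n3 : ∀ i, (eU.symm i : V) ≠ u := fun i hi => h.base_notMem_right (hi ▸ hUm i)
  have n4 : ∀ i, (eU.symm i : V) ≠ c := fun i hi => h.spine_notMem_right (hi ▸ hUm i)
  have n5 : ∀ i j, (eL.symm i : V) ≠ eU.symm j := fun i j hi =>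
    Finset.disjoint_left.1 h.disjoint (hLm i) (hi ▸ hUm j)
  have m1 : ∀ i, (eU.symm i : V) ∉ L := fun i hi => Finset.disjoint_left.1 h.disjoint hi (hUm i)
  have hne := h.spine_ne
  have hbij : Function.Bijective f := by
    constructor
    · rintro ((i | i) | i) ((j | j) | j) hij
      · fin_cases i <;> fin_cases j <;> simp [f, hne, hne.symm] at hij ⊢
      · fin_cases i <;> simp [f, (n1 j).symm, (n2 j).symm] at hij
      · fin_cases i <;> simp [f, (n3 j).symm, (n4 j).symm] at hij
      · fin_cases j <;> simp [f, n1 i, n2 i] at hij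
      · simpa [f, Subtype.ext_iff.symm] using hij
      · exact (n5 i j hij).elim
      · fin_cases j <;> simp [f, n3 i, n4 i] at hij
      · exact (n5 j i hij.symm).elim
      · simpa [f, Subtype.ext_iff.symm] using hij
    · intro v
      rcases h.cover v with rfl | rfl | hv | hv
      · exact ⟨Sum.inl (Sum.inl 0), rfl⟩
      · exact ⟨Sum.inl (Sum.inl 1), rfl⟩
      · exact ⟨Sum.inl (Sum.inr (eL ⟨v, hv⟩)), by simp [f]⟩
      · exact ⟨Sum.inr (eU ⟨v, hv⟩), by simp [f]⟩
  refine ⟨RelIso.symm ⟨Equiv.ofBijective f hbij, ?_⟩⟩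
  rintro ((i | i) | i) ((j | j) | j)
  · fin_cases i <;> fin_cases j <;>
      simp [f, splitPendant, attachPendants, completeSplit, join, h.adj_base, h.adj_spine, hne]
  · fin_cases i <;>
      simp [f, splitPendant, attachPendants, completeSplit, join, h.adj_base, h.adj_spine, n1, hLm]
  · fin_cases i <;>
      simp [f, splitPendant, attachPendants, completeSplit, join, h.adj_base, h.adj_spine, n3, m1]
  · fin_cases j <;>
      simp [f, splitPendant, attachPendants, completeSplit, join, h.adj_page _ (hLm i)]
  · simp [f, splitPendant, attachPendants, completeSplit, join, h.adj_page _ (hLm i), n1, n2]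
  · simp [f, splitPendant, attachPendants, completeSplit, join, h.adj_page _ (hLm i), n3, n4]
  · fin_cases j <;>
      simp [f, splitPendant, attachPendants, completeSplit, join, h.adj_pendant _ (hUm i), hne]
  · simp [f, splitPendant, attachPendants, completeSplit, join, h.adj_pendant _ (hUm i), n1]
  · simp [f, splitPendant, attachPendants, completeSplit, join, h.adj_pendant _ (hUm i), n3]

omit [Fintype V] [DecidableEq V] [DecidableRel G.Adj] in
theorem nonempty_iso_completeSplit (h : IsPendantBook G u c L U) {n : ℕ}
    (hL : L.card = n - 2) (hU : U.card = 0) : Nonempty (G ≃g completeSplit n 2) := by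
  obtain ⟨e⟩ := h.nonempty_iso_splitPendant (n := n) (t := 0) hL hU
  refine ⟨e.trans ⟨Equiv.sumEmpty _ _, ?_⟩⟩
  rintro (a | a) (b | b)
  · simp [splitPendant, attachPendants]
  · exact b.elim0
  · exact a.elim0
  · exact a.elim0

end IsPendantBook

/-- A zero of the quartic is an eigenvalue, with an eigenvector constant on pages and on pendant
vertices. -/
theorem le_lam_of_iso_splitPendant {n t : ℕ} (e : G ≃g splitPendant n 2 t) {k : ℕ}
    (hk : n - t - 2 = k) {ρ : ℝ} (hρ : 0 < ρ) (hq : bookQuartic k t ρ = 0) : ρ ≤ lam G := by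
  classical
  subst hk
  set r : ℝ := ((n - t - 2 : ℕ) : ℝ) with hr
  -- With page entries 1, the page equation forces `x₁ + x₂ = ρ` and the equation at the second
  -- spine vertex forces this `x₂`. The equation at the first spine vertex is then the quartic.
  set x₂ := (ρ + r) / (ρ + 1) with hx₂
  set x₁ := ρ - x₂ with hx₁
  let z : (Fin 2 ⊕ Fin (n - t - 2)) ⊕ Fin t → ℝ :=
    Sum.elim (Sum.elim ![x₁, x₂] fun _ => 1) fun _ => x₁ / ρ
  have h2 : x₂ * (ρ + 1) = ρ + r := div_mul_cancel₀ _ (by positivity)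
  have h1 : ρ * x₁ = x₂ + r + t * (x₁ / ρ) := by
    unfold bookQuartic at hq
    have hx : x₁ * (ρ + 1) = ρ ^ 2 - r := by rw [hx₁]; linear_combination -h2
    have hp : ρ + 1 ≠ 0 := by positivity
    field_simp
    apply mul_right_cancel₀ hp
    linear_combination hq + (ρ ^ 2 - t) * hx - ρ * h2
  have hz : ∀ b, ∑ b', (if (splitPendant n 2 t).Adj b b' then z b' else 0) = ρ * z b := by
    rintro ((i | i) | i)
    · fin_cases i
      · simp [Fintype.sum_sum_type, splitPendant, attachPendants, completeSplit, join, z, ← hr]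
        linarith
      · simp [Fintype.sum_sum_type, splitPendant, attachPendants, completeSplit, join, z, ← hr]
        rw [hx₁]; linarith
    · simp [Fintype.sum_sum_type, splitPendant, attachPendants, completeSplit, join, z, hx₁]
    · simp [Fintype.sum_sum_type, splitPendant, attachPendants, completeSplit, join, z]
      field_simp
  have : Nonempty V := ⟨e.symm (Sum.inl (Sum.inl 0))⟩
  obtain ⟨-, -, -, -, hmax⟩ := exists_nonneg_mulVec_eq_lam_smul G
  refine (le_abs_self ρ).trans (hmax ρ (fun v => z (e v)) ?_ ?_)
  -- There may be no pages, so the spine entries are used: both vanishing would give `ρ = x₁ + x₂ =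
  -- 0`.
  · intro h0
    have ha := congrFun h0 (e.symm (Sum.inl (Sum.inl 0)))
    have hb := congrFun h0 (e.symm (Sum.inl (Sum.inl 1)))
    simp [z] at ha hb
    linarith
  · ext v
    rw [Pi.smul_apply, smul_eq_mul, ← hz, Matrix.mulVec, dotProduct, ← e.toEquiv.sum_comp]
    refine Finset.sum_congr rfl fun w _ => ?_
    rw [SimpleGraph.adjMatrix_apply, ite_mul, one_mul, zero_mul]
    congr 1
    exact propext e.map_adj_iff.symm

/-- A member of the family of large spectral radius is the book with `t` pendant edges. -/
theorem InFamily.extremal {m k t : ℕ} (hG : InFamily m G) (hk : 10 ≤ k) (hm : m = 2 * k + t + 1)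
    (ht : Even m ∧ t = 1 ∨ Odd m ∧ t = 2) (h0 : 0 < lam G)
    (hlam : 2 * (k : ℝ) < lam G ^ 2 - lam G) (hq : 0 ≤ bookQuartic k t (lam G)) :
    bookQuartic k t (lam G) = 0 ∧
      ∀ n, n - t - 2 = k → Nonempty (G ≃g splitPendant n 2 t) := by
  have : Nonempty V := by
    by_contra hV
    rw [not_nonempty_iff] at hV
    have h1 := hG.size
    rw [Finset.eq_empty_of_isEmpty G.edgeFinset, Finset.card_empty] at h1
    omega
  obtain ⟨y, hy0, hyne, hy, -⟩ := exists_nonneg_mulVec_eq_lam_smul G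
  obtain ⟨u, -, hu⟩ := Finset.exists_max_image Finset.univ y Finset.univ_nonempty
  have hyu : 0 < y u := by
    refine lt_of_le_of_ne (hy0 u) fun h => hyne ?_
    ext v
    exact le_antisymm ((hu v (Finset.mem_univ v)).trans h.symm.le) (hy0 v)
  have hx : ∀ v, lam G * (y v / y u) = ∑ z ∈ G.neighborFinset v, y z / y u := by
    intro v
    have := congrFun hy v
    rw [SimpleGraph.adjMatrix_mulVec_apply, Pi.smul_apply, smul_eq_mul] at this
    rw [← Finset.sum_div, this, mul_div_assoc]
  have htpos : (0 : ℝ) < t := by rcases ht with ⟨-, rfl⟩ | ⟨-, rfl⟩ <;> norm_num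
  have hk' : (10 : ℝ) ≤ k := by exact_mod_cast hk
  obtain ⟨c, hc, hfar, hleaf, hrest, hr⟩ := (noPentagon_of_free hG.c5Free).exists_spine (u := u)
    hG.noIsolated hx (fun v => div_nonneg (hy0 v) hyu.le)
    (fun v => (div_le_one hyu).2 (hu v (Finset.mem_univ v))) (div_self hyu.ne')
    -- From `k ≥ 10`, `λ² - λ > 20`, which is exactly `λ > 5`; this is where `m ≥ 22` enters.
    (by nlinarith) (k := k) (t := t) (by tauto) (hG.size.trans hm)
    (lt_sq_sub_of_bookQuartic_nonneg htpos h0 hlam hq)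
  have hB := isPendantBook_of_spine hc hfar hleaf hrest
  have hquart := hB.bookQuartic_eq_zero hx (div_self hyu.ne')
  have hsize := star_size hc hleaf hrest
  rw [hfar, Finset.sum_empty, Finset.sum_empty, hG.size] at hsize
  have hrL : codeg G u c = (G.neighborFinset c ∩ G.neighborFinset u).card := rfl
  rw [hrL] at hr hsize
  generalize G.neighborFinset c ∩ G.neighborFinset u = L at *
  generalize G.neighborFinset u \ insert c L = U at *
  have hUt : U.card = t := by
    by_contra hne
    -- The size fixes the parity of `U.card`, equal to that of `t`. For even `m` it is therefore at
    -- least 1; for odd `m` the value 0 is the excluded book.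
    have hlt : t < U.card := by
      rcases ht with ⟨⟨j, hj⟩, rfl⟩ | ⟨ho, rfl⟩
      · omega
      · have hU0 : U.card ≠ 0 := by
          intro hU0
          obtain ⟨e⟩ := hB.nonempty_iso_completeSplit (n := (m + 3) / 2) (by omega) hU0
          exact (hG.notBook ho).false e
        omega
    refine (bookQuartic_neg_of_pendants h0 ?_ ?_ ?_ hquart).not_ge hq
    · have : t ≤ 2 * L.card := by omega
      exact_mod_cast this
    · exact_mod_cast hlt
    · have : 2 * L.card + U.card = 2 * k + t := by omega
      exact_mod_cast this
  have hLk : L.card = k := by omega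
  rw [hLk, hUt] at hquart
  exact ⟨hquart, fun n hn => hB.nonempty_iso_splitPendant (hLk.trans hn.symm) hUt⟩

end Extremal
end SizeSpectral

theorem theorem1p3 (m : ℕ) (hm : 22 ≤ m) {V : Type*} [Fintype V] [DecidableEq V]
    (G : SimpleGraph V) [DecidableRel G.Adj] (hG : SizeSpectral.InFamily m G) :
    IsGreatest {x : ℝ | SizeSpectral.psi1 m x = 0} (SizeSpectral.rho1 m) ∧
    SizeSpectral.lam G ≤ SizeSpectral.rho1 m ∧
    (SizeSpectral.lam G = SizeSpectral.rho1 m ↔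
      (Even m ∧ Nonempty (G ≃g SizeSpectral.splitPendant ((m + 4) / 2) 2 1)) ∨
      (Odd m ∧ Nonempty (G ≃g SizeSpectral.splitPendant ((m + 5) / 2) 2 2))) := by
  open SizeSpectral in
  obtain ⟨k, t, hk, hmk, ht⟩ := exists_size_eq hm
  have hk0 : (0 : ℝ) < k := by exact_mod_cast (by omega : 0 < k)
  have ht0 : (0 : ℝ) < t := by exact_mod_cast (by omega : 0 < t)
  obtain ⟨ρ, hρ, hρ0, hge⟩ := exists_isGreatest_bookQuartic hk0 ht0
  have hset : {x : ℝ | psi1 m x = 0} = {x | bookQuartic k t x = 0} := by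
    ext x
    rw [Set.mem_ofPred_eq, Set.mem_ofPred_eq, psi1_eq_bookQuartic hmk ht]
  have hrho : rho1 m = ρ := by rw [rho1, hset, hρ.csSup_eq]
  rw [hrho, hset]
  -- This serves twice: it makes `lam G` a zero, so that it cannot exceed `ρ`, and it identifies `G`
  -- in case of equality.
  have hext : ρ ≤ lam G → bookQuartic k t (lam G) = 0 ∧
      ∀ n, n - t - 2 = k → Nonempty (G ≃g splitPendant n 2 t) := fun h =>
    hG.extremal hk hmk ht (hρ0.trans_le h) (hge _ h).1 (hge _ h).2
  have hle : lam G ≤ ρ := by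
    by_contra h
    exact h (hρ.2 (hext (not_le.1 h).le).1)
  refine ⟨hρ, hle, fun h => ?_, fun h => le_antisymm hle ?_⟩
  · have hiso := (hext h.ge).2
    rcases ht with ⟨he, rfl⟩ | ⟨ho, rfl⟩
    · exact Or.inl ⟨he, hiso _ (by omega)⟩
    · exact Or.inr ⟨ho, hiso _ (by omega)⟩
  · rcases h with ⟨he, ⟨e⟩⟩ | ⟨ho, ⟨e⟩⟩
    · rcases ht with ⟨-, rfl⟩ | ⟨ho, -⟩
      · exact le_lam_of_iso_splitPendant e (by omega) hρ0 hρ.1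
      · exact (Nat.not_even_iff_odd.2 ho he).elim
    · rcases ht with ⟨he, -⟩ | ⟨-, rfl⟩
      · exact (Nat.not_even_iff_odd.2 ho he).elim
      · exact le_lam_of_iso_splitPendant e (by omega) hρ0 hρ.1
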